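/- Let $N$ be a smooth manifold of dimension $2n+1$ with an almost contact metric structure $(\phi,\xi,\eta,g)$: $g$ is a Riemannian metric with Levi-Civita connection $\bar\nabla$, $\phi$ is a $(1,1)$-tensor field, $\xi$ a vector field and $\eta$ a $1$-form (all smooth) with $\phi^2X=-X+\eta(X)\xi$, $\phi\xi=0$, $\eta(\xi)=1$, $g(X,\xi)=\eta(X)$, $\eta(\phi X)=0$, $g(\phi X,\phi Y)=g(X,Y)-\eta(X)\eta(Y)$ and $g(\phi X,Y)=-g(X,\phi Y)$. Suppose that $N$ is SQ-Sasakian (special quasi-Sasakian) with structure function $\beta$: $\beta$ is a smooth function on $N$ with $\xi\beta=0$ and $\bar\nabla_X\xi=-\beta\phi X$ for all $X$, the $2$-form $\Phi(X,Y)=g(X,\phi Y)$ is closed, and the structure is normal, that is, $$[\phi X,\phi Y]+\phi^2[X,Y]-\phi[\phi X,Y]-\phi[X,\phi Y]+2d\eta(X,Y)\xi=0,$$ where $2d\eta(X,Y)=X\eta(Y)-Y\eta(X)-\eta([X,Y])$. Let $M$ be an (immersed) invariant submanifold of $N$ of dimension $2m+1$: $\xi$ is tangent to $M$ at every point of $M$,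 and $\phi(TM)\subset TM$. Let $g$ also denote the induced metric on $M$, let $\nabla$ and $\nabla^\perp$ be the induced connections on $TM$ and on the normal bundle, let $h$ be the second fundamental form (so $\bar\nabla_XY=\nabla_XY+h(X,Y)$), and let $H=\frac1{\dim M}\operatorname{tr}_g h$ be the mean curvature vector. Call $M$ totally geodesic if $h=0$. For a normal-bundle-valued $(0,2)$-tensor field $T$ on $M$ put $(\bar\nabla_XT)(Z,U)=\nabla^\perp_X(T(Z,U))-T(\nabla_XZ,U)-T(Z,\nabla_XU)$, and put $$\bar R(X,Y)\cdot h=(\bar\nabla_X\bar\nabla_Y-\bar\nabla_Y\bar\nabla_X-\bar\nabla_{[X,Y]})h,$$ $$Q(g,h)(Z,U;X,Y)=g(Y,Z)h(X,U)-g(X,Z)h(Y,U)+g(Y,U)h(X,Z)-g(X,U)h(Y,Z).$$ Let $W=\{x\in M:(h-Hg)_x\neq0\}$. For a function $L_h:W\to\mathbb R$, $M$ is called Deszcz-pseudo parallel with $L_h$ if $(\bar R(X,Y)\cdot h)(Z,U)=L_h\,Q(g,h)(Z,U;X,Y)$ on $W$ for all vector fields $X,Y,Z,U$ on $M$. Theorem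 3.2. $M$ is totally geodesic if and only if there is a function $L_h:W\to\mathbb R$ such that $M$ is Deszcz-pseudo parallel with $L_h$ and $L_h(x)+\beta(x)^2\neq0$ for every $x\in W$. -/

import Mathlib

open Set Bundle VectorField
open scoped Manifold ContDiff

noncomputable section

section Ambient

/-! ### Ambient Riemannian manifold `N`, with metric `⟪·, ·⟫` on its tangent spaces -/

variable {F : Type*} [NormedAddCommGroup F] [NormedSpace ℝ F] [FiniteDimensional ℝ F]
  {G : Type*} [TopologicalSpace G] (J : ModelWithCorners ℝ F G)
  (N : Type*) [TopologicalSpace N] [ChartedSpace G N] [IsManifold J ∞ N]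
  [RiemannianBundle (fun y : N ↦ TangentSpace J y)]
  [IsContMDiffRiemannianBundle J ∞ F (fun y : N ↦ TangentSpace J y)]

/-- `X` is a smooth vector field on the manifold `N`. -/
def IsSmoothVF {F : Type*} [NormedAddCommGroup F] [NormedSpace ℝ F]
    {G : Type*} [TopologicalSpace G] (J : ModelWithCorners ℝ F G)
    {N : Type*} [TopologicalSpace N] [ChartedSpace G N] [IsManifold J ∞ N]
    (X : (y : N) → TangentSpace J y) : Prop :=
  ContMDiff J J.tangent ∞ (fun y ↦ (⟨y, X y⟩ : TangentBundle J N))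

variable {J N} in
/-- `nabla` is the Levi-Civita connection of `N`: a linear connection (it sends smooth vector fields
to smooth fields of endomorphisms) which is torsion-free and satisfies
`v⟨Y, Z⟩ = ⟨∇_v Y, Z⟩ + ⟨Y, ∇_v Z⟩` for tangent vectors `v` and differentiable fields `Y`, `Z`.
`nabla Y y v` is `(∇_v Y)(y)`. -/
structure IsLeviCivita
    (nabla : CovariantDerivative J F (fun y : N ↦ TangentSpace J y)) : Prop where
  smooth : CovariantDerivative.ContMDiffCovariantDerivative nabla ∞
  torsion_free : nabla.torsion = 0
  metric : ∀ (Y Z : (y : N) → TangentSpace J y) (y : N) (v : TangentSpace J y),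
    MDifferentiableAt J J.tangent (fun z ↦ (⟨z, Y z⟩ : TangentBundle J N)) y →
    MDifferentiableAt J J.tangent (fun z ↦ (⟨z, Z z⟩ : TangentBundle J N)) y →
    mvfderiv J (fun z ↦ inner ℝ (Y z) (Z z)) y v =
      inner ℝ (nabla Y y v) (Z y) + inner ℝ (Y y) (nabla Z y v)

/-- An almost contact metric structure `(φ, ξ, η, g)` on `N`, where `g` is the Riemannian
metric of `N`. -/
structure AlmostContactMetric where
  /-- the tensor field of type `(1,1)` -/
  phi : (y : N) → TangentSpace J y →L[ℝ] TangentSpace J y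
  /-- the structure vector field -/
  xi : (y : N) → TangentSpace J y
  /-- the structure `1`-form -/
  eta : (y : N) → TangentSpace J y →L[ℝ] ℝ
  phi_smooth : ContMDiff J (J.prod 𝓘(ℝ, F →L[ℝ] F)) ∞
    (fun y ↦ TotalSpace.mk' (F →L[ℝ] F)
      (E := fun y : N ↦ TangentSpace J y →L[ℝ] TangentSpace J y) y (phi y))
  xi_smooth : IsSmoothVF J xi
  eta_smooth : ContMDiff J (J.prod 𝓘(ℝ, F →L[ℝ] ℝ)) ∞
    (fun y ↦ TotalSpace.mk' (F →L[ℝ] ℝ)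
      (E := fun y : N ↦ TangentSpace J y →L[ℝ] Bundle.Trivial N ℝ y) y (eta y))
  phi_phi : ∀ y v, phi y (phi y v) = -v + eta y v • xi y
  phi_xi : ∀ y, phi y (xi y) = 0
  eta_xi : ∀ y, eta y (xi y) = 1
  inner_xi : ∀ y v, inner ℝ v (xi y) = eta y v
  eta_phi : ∀ y v, eta y (phi y v) = 0
  inner_phi_phi : ∀ y v w, inner ℝ (phi y v) (phi y w) = inner ℝ v w - eta y v * eta y w
  inner_phi_left : ∀ y v w, inner ℝ (phi y v) w = -inner ℝ v (phi y w)

namespace AlmostContactMetric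

variable {J N} (S : AlmostContactMetric J N)

/-- The vector field `φX`. -/
def phiVF (X : (y : N) → TangentSpace J y) : (y : N) → TangentSpace J y :=
  fun y ↦ S.phi y (X y)

/-- The fundamental `2`-form `Φ(X, Y) = g(X, φY)`, as a function on `N`. -/
def fund (X Y : (y : N) → TangentSpace J y) : N → ℝ :=
  fun y ↦ inner ℝ (X y) (S.phi y (Y y))

/-- The exterior derivative `dΦ(X, Y, Z)`, up to the conventional constant factor. -/
def dFund (X Y Z : (y : N) → TangentSpace J y) (y : N) : ℝ :=
  mvfderiv J (S.fund Y Z) y (X y) + mvfderiv J (S.fund Z X) y (Y y)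
    + mvfderiv J (S.fund X Y) y (Z y)
    - S.fund (mlieBracket J X Y) Z y - S.fund (mlieBracket J Y Z) X y
    - S.fund (mlieBracket J Z X) Y y

/-- `2 dη(X, Y) = X η(Y) - Y η(X) - η([X, Y])`. -/
def twoDEta (X Y : (y : N) → TangentSpace J y) (y : N) : ℝ :=
  mvfderiv J (fun z ↦ S.eta z (Y z)) y (X y) - mvfderiv J (fun z ↦ S.eta z (X z)) y (Y y)
    - S.eta y (mlieBracket J X Y y)

/-- The Nijenhuis tensor
`N(X, Y) = [φX, φY] + φ²[X, Y] - φ[φX, Y] - φ[X, φY] + 2 dη(X, Y) ξ`. -/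
def nijenhuis (X Y : (y : N) → TangentSpace J y) (y : N) : TangentSpace J y :=
  mlieBracket J (S.phiVF X) (S.phiVF Y) y + S.phi y (S.phi y (mlieBracket J X Y y))
    - S.phi y (mlieBracket J (S.phiVF X) Y y) - S.phi y (mlieBracket J X (S.phiVF Y) y)
    + S.twoDEta X Y y • S.xi y

/-- The almost contact metric structure `S` is SQ-Sasakian (special quasi-Sasakian) with structure
function `β`; `nabla` is the Levi-Civita connection. -/
structure IsSQSasakian
    (nabla : CovariantDerivative J F (fun y : N ↦ TangentSpace J y)) (β : N → ℝ) : Prop where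
  beta_smooth : ContMDiff J 𝓘(ℝ, ℝ) ∞ β
  xi_beta : ∀ y, mvfderiv J β y (S.xi y) = 0
  fund_closed : ∀ X Y Z, IsSmoothVF J X → IsSmoothVF J Y → IsSmoothVF J Z →
    ∀ y, S.dFund X Y Z y = 0
  normal : ∀ X Y, IsSmoothVF J X → IsSmoothVF J Y → ∀ y, S.nijenhuis X Y y = 0
  nabla_xi : ∀ y v, nabla S.xi y v = -(β y • S.phi y v)

end AlmostContactMetric

end Ambient

section Submanifold

/-! ### Immersed submanifolds `f : M → N` -/

variable {E : Type*} [NormedAddCommGroup E] [NormedSpace ℝ E] [FiniteDimensional ℝ E]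
  {H : Type*} [TopologicalSpace H] (I : ModelWithCorners ℝ E H)
  {F : Type*} [NormedAddCommGroup F] [NormedSpace ℝ F] [FiniteDimensional ℝ F]
  {G : Type*} [TopologicalSpace G] {J : ModelWithCorners ℝ F G}
  {M : Type*} [TopologicalSpace M] [ChartedSpace H M] [IsManifold I ∞ M]
  {N : Type*} [TopologicalSpace N] [ChartedSpace G N] [IsManifold J ∞ N]
  [RiemannianBundle (fun y : N ↦ TangentSpace J y)]
  [IsContMDiffRiemannianBundle J ∞ F (fun y : N ↦ TangentSpace J y)]
  (nabla : CovariantDerivative J F (fun y : N ↦ TangentSpace J y))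
  (f : M → N)

variable (J) in
/-- `f : M → N` makes `M` an (immersed) submanifold of `N`. -/
structure IsImmersedSubmanifold : Prop where
  smooth : ContMDiff I J ∞ f
  injective_mfderiv : ∀ x, Function.Injective (mfderiv I J f x)

variable (J) in
/-- The tangent space of the submanifold at `x`, as a subspace of `T_{f x} N`. -/
def tangentRange (x : M) : Submodule ℝ (TangentSpace J (f x)) :=
  (mfderiv I J f x).range

instance (x : M) : FiniteDimensional ℝ (tangentRange I J f x) :=
  haveI : FiniteDimensional ℝ (TangentSpace I x) := inferInstanceAs (FiniteDimensional ℝ E)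
  inferInstanceAs (FiniteDimensional ℝ (mfderiv I J f x).range)

/-- The normal component of a vector of `T_{f x} N`. -/
def normalPart (x : M) (v : TangentSpace J (f x)) : TangentSpace J (f x) :=
  v - (tangentRange I J f x).starProjection v

/-- The tangential component of a vector of `T_{f x} N`, as a tangent vector of `M`: the vector `u`
whose image `df u` is the orthogonal projection of `v` to the tangent space of the submanifold. -/
def tangentPart (x : M) (v : TangentSpace J (f x)) : TangentSpace I x :=
  Function.invFun (mfderiv I J f x) ((tangentRange I J f x).starProjection v)

variable (J) in
/-- The vector field `df(X)` along `f`. -/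
def pushVF (X : (x : M) → TangentSpace I x) (x : M) : TangentSpace J (f x) :=
  mfderiv I J f x (X x)

variable (J) in
/-- The induced metric `g(X, Y)` on `M`. -/
def inducedMetric (X Y : (x : M) → TangentSpace I x) (x : M) : ℝ :=
  inner ℝ (pushVF I J f X x) (pushVF I J f Y x)

/-- The ambient covariant derivative `∇̄_u V` at `x` of a vector field `V` along `f`. In the local
frame `e_i` of `TN` given by the preferred trivialization at `f x`, writing `V = ∑ Vⁱ (e_i ∘ f)`, it
is `∑ Vⁱ(x) (∇̄_{df u} e_i)(f x) + ∑ u(Vⁱ) e_i(f x)`. -/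
def covAlong (V : (x : M) → TangentSpace J (f x)) (x : M) (u : TangentSpace I x) :
    TangentSpace J (f x) :=
  nabla (FiberBundle.extend F (V x)) (f x) (mfderiv I J f x u)
    + (trivializationAt F (fun y : N ↦ TangentSpace J y) (f x)).symm (f x)
        (mvfderiv I (fun z : M ↦ (trivializationAt F (fun y : N ↦ TangentSpace J y) (f x)
          (⟨f z, V z⟩ : TangentBundle J N)).2) x u)

/-- The second fundamental form `h(X, Y)`: the normal component of `∇̄_X Y`. -/
def sff (X Y : (x : M) → TangentSpace I x) (x : M) : TangentSpace J (f x) :=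
  normalPart I f x (covAlong I nabla f (pushVF I J f Y) x (X x))

/-- The induced connection on `TM`: `∇_X Y` is the tangential component of `∇̄_X Y`. -/
def inducedCov (X Y : (x : M) → TangentSpace I x) (x : M) : TangentSpace I x :=
  tangentPart I f x (covAlong I nabla f (pushVF I J f Y) x (X x))

/-- The normal connection: `∇^⊥_X V` is the normal component of `∇̄_X V`. -/
def normalCov (X : (x : M) → TangentSpace I x) (V : (x : M) → TangentSpace J (f x)) (x : M) :
    TangentSpace J (f x) :=
  normalPart I f x (covAlong I nabla f V x (X x))

/-- The covariant derivative of a normal bundle valued `(0,2)`-tensor field `T`: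
`(∇̄_X T)(Z, U) = ∇^⊥_X (T(Z, U)) - T(∇_X Z, U) - T(Z, ∇_X U)`. -/
def covTensor (X : (x : M) → TangentSpace I x)
    (T : ((x : M) → TangentSpace I x) → ((x : M) → TangentSpace I x) →
      (x : M) → TangentSpace J (f x))
    (Z U : (x : M) → TangentSpace I x) (x : M) : TangentSpace J (f x) :=
  normalCov I nabla f X (T Z U) x - T (inducedCov I nabla f X Z) U x
    - T Z (inducedCov I nabla f X U) x

/-- `(R̄(X, Y) · h)(Z, U)`, where `R̄(X, Y) · h = (∇̄_X ∇̄_Y - ∇̄_Y ∇̄_X - ∇̄_[X, Y]) h`. -/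
def curvatureSff (X Y Z U : (x : M) → TangentSpace I x) (x : M) : TangentSpace J (f x) :=
  covTensor I nabla f X (covTensor I nabla f Y (sff I nabla f)) Z U x
    - covTensor I nabla f Y (covTensor I nabla f X (sff I nabla f)) Z U x
    - covTensor I nabla f (mlieBracket I X Y) (sff I nabla f) Z U x

/-- `Q(g, h)(Z, U; X, Y) = g(Y, Z) h(X, U) - g(X, Z) h(Y, U) + g(Y, U) h(X, Z) - g(X, U) h(Y, Z)`. -/
def tachibana (X Y Z U : (x : M) → TangentSpace I x) (x : M) : TangentSpace J (f x) :=
  inducedMetric I J f Y Z x • sff I nabla f X U x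
    - inducedMetric I J f X Z x • sff I nabla f Y U x
    + inducedMetric I J f Y U x • sff I nabla f X Z x
    - inducedMetric I J f X U x • sff I nabla f Y Z x

/-- The mean curvature vector `H = (1 / dim M) ∑ h(e_i, e_i)` at `x`, where `(e_i)` is an orthonormal
basis of the tangent space of the submanifold at `x`. -/
def meanCurvature (x : M) : TangentSpace J (f x) :=
  (Module.finrank ℝ E : ℝ)⁻¹ •
    ∑ i, sff I nabla f
      (FiberBundle.extend E
        (tangentPart I f x (stdOrthonormalBasis ℝ (tangentRange I J f x) i : TangentSpace J (f x))))
      (FiberBundle.extend E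
        (tangentPart I f x (stdOrthonormalBasis ℝ (tangentRange I J f x) i : TangentSpace J (f x))))
      x

/-- `M` is totally geodesic: `h = 0`. -/
def IsTotallyGeodesic : Prop :=
  ∀ X Y, IsSmoothVF I X → IsSmoothVF I Y → ∀ x, sff I nabla f X Y x = 0

/-- The set `W` of the points `x` of `M` where `h - H g ≠ 0`. -/
def nonUmbilicSet : Set M :=
  {x | ∃ X Y, IsSmoothVF I X ∧ IsSmoothVF I Y ∧
    sff I nabla f X Y x - inducedMetric I J f X Y x • meanCurvature I nabla f x ≠ 0}

/-- `M` is Deszcz-pseudo parallel with function `L` on `W`: `R̄(X, Y) · h = L Q(g, h)` on `W` for all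
vector fields `X, Y` tangent to `M`. -/
def IsDeszczPseudoParallel (L : nonUmbilicSet I nabla f → ℝ) : Prop :=
  ∀ X Y Z U, IsSmoothVF I X → IsSmoothVF I Y → IsSmoothVF I Z → IsSmoothVF I U →
    ∀ x : nonUmbilicSet I nabla f,
      curvatureSff I nabla f X Y Z U x = L x • tachibana I nabla f X Y Z U x

/-- `M` is an invariant submanifold: `ξ` is tangent to `M` and `φ(TM) ⊆ TM`. -/
structure IsInvariantSubmanifold (S : AlmostContactMetric J N) : Prop where
  immersed : IsImmersedSubmanifold I J f
  xi_tangent : ∀ x, S.xi (f x) ∈ tangentRange I J f x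
  phi_tangent : ∀ x, ∀ v ∈ tangentRange I J f x, S.phi (f x) v ∈ tangentRange I J f x

end Submanifold

end

set_option linter.unusedSectionVars false

noncomputable section

section LieBracketDerivation

open scoped Topology

variable {E : Type*} [NormedAddCommGroup E] [NormedSpace ℝ E] [FiniteDimensional ℝ E]
  {H : Type*} [TopologicalSpace H] {I : ModelWithCorners ℝ E H}
  {M : Type*} [TopologicalSpace M] [ChartedSpace H M] [IsManifold I ∞ M]

/-- Every tangent vector extends to a smooth vector field which, near the base point, is constant
in the preferred trivialization. -/
theorem exists_isSmoothVF_eventuallyEq_extend [T2Space M] {x : M} (v : TangentSpace I x) :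
    ∃ X : (y : M) → TangentSpace I y, IsSmoothVF I X ∧ X =ᶠ[𝓝 x] FiberBundle.extend E (E := fun y : M ↦ TangentSpace I y) v := by
  obtain ⟨s, hs, hsmooth⟩ := FiberBundle.exists_contMDiffOn_extend (k := ∞) I E v
  obtain ⟨ρ, -, hρ⟩ := (SmoothBumpFunction.nhds_basis_tsupport (I := I) x).mem_iff.1
    (interior_mem_nhds.2 hs)
  refine ⟨fun y ↦ ρ y • FiberBundle.extend E (E := fun y : M ↦ TangentSpace I y) v y, ?_, ?_⟩
  · exact ContMDiffOn.smul_section_of_tsupport (u := interior s) ρ.contMDiff.contMDiffOn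
      isOpen_interior hρ (hsmooth.mono interior_subset)
  · filter_upwards [ρ.eventuallyEq_one] with y hy
    simp only [hy, Pi.one_apply, one_smul]
    rfl

omit [FiniteDimensional ℝ E] [IsManifold I ∞ M] in
theorem Filter.EventuallyEq.mvfderiv_eq {F : Type*} [NormedAddCommGroup F] [NormedSpace ℝ F]
    {g h : M → F} {x : M} (hgh : g =ᶠ[𝓝 x] h) : mvfderiv I g x = mvfderiv I h x := by
  have := hgh.mfderiv_eq (I := I) (I' := 𝓘(ℝ, F))
  ext v
  exact DFunLike.congr_fun this v

omit [FiniteDimensional ℝ E] in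
theorem ContMDiffAt.mvfderiv_apply {F : Type*} [NormedAddCommGroup F] [NormedSpace ℝ F]
    {g : M → F} {X : (y : M) → TangentSpace I y} {x : M} (hg : ContMDiffAt I 𝓘(ℝ, F) ∞ g x)
    (hX : ContMDiffAt I I.tangent ∞ (fun y ↦ (⟨y, X y⟩ : TangentBundle I M)) x) :
    ContMDiffAt I 𝓘(ℝ, F) ∞ (fun y ↦ mvfderiv I g y (X y)) x := by
  have h := ContMDiffAt.clm_apply_of_inCoordinates (b₁ := id) (b₂ := g)
    (ContMDiffAt.mfderiv_const (m := ∞) hg le_rfl) hX hg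
  exact (contMDiff_snd_tangentBundle_modelSpace F 𝓘(ℝ, F)).contMDiffAt.comp x h

theorem isSmoothVF_mlieBracket {X Y : (x : M) → TangentSpace I x} (hX : IsSmoothVF I X)
    (hY : IsSmoothVF I Y) : IsSmoothVF I (mlieBracket I X Y) := by
  have : CompleteSpace E := FiniteDimensional.complete ℝ E
  have h2 : IsManifold I (minSmoothness ℝ 2) M := by
    rw [minSmoothness_of_isRCLikeNormedField]
    exact .of_le (n := ∞) (by norm_cast)
  have : IsManifold I ((⊤ : ℕ∞) + 1) M := inferInstanceAs (IsManifold I ∞ M)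
  intro x
  refine ContMDiffAt.mlieBracket_vectorField (m := ⊤) (n := ⊤) (hX x) (hY x) ?_
  rw [minSmoothness_of_isRCLikeNormedField]
  rfl

theorem mvfderiv_mlieBracket_apply_real {g : M → ℝ} {X Y : (y : M) → TangentSpace I y} {x : M}
    (hg : ContMDiffAt I 𝓘(ℝ, ℝ) ∞ g x)
    (hX : ContMDiffAt I I.tangent ∞ (fun y ↦ (⟨y, X y⟩ : TangentBundle I M)) x)
    (hY : ContMDiffAt I I.tangent ∞ (fun y ↦ (⟨y, Y y⟩ : TangentBundle I M)) x) :
    mvfderiv I g x (mlieBracket I X Y x) =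
      mvfderiv I (fun y ↦ mvfderiv I g y (Y y)) x (X x)
        - mvfderiv I (fun y ↦ mvfderiv I g y (X y)) x (Y x) := by
  have : CompleteSpace E := FiniteDimensional.complete ℝ E
  have h3 : IsManifold I (minSmoothness ℝ 3) M := by
    rw [minSmoothness_of_isRCLikeNormedField]
    exact .of_le (n := ∞) (by norm_cast)
  have h2 : IsManifold I (minSmoothness ℝ 2) M := by
    rw [minSmoothness_of_isRCLikeNormedField]
    exact .of_le (n := ∞) (by norm_cast)
  have hle : minSmoothness ℝ 2 ≤ ∞ := by
    rw [minSmoothness_of_isRCLikeNormedField]; norm_cast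
  cases subsingleton_or_nontrivial E with
  | inl hE =>
    have (v : TangentSpace I x) : v = 0 := Subsingleton.elim (α := E) v 0
    rw [this (X x), this (Y x), this (mlieBracket I X Y x)]
    simp
  | inr hE =>
  obtain ⟨w, hw⟩ := exists_ne (0 : E)
  let w' : TangentSpace I x := w
  let Z := FiberBundle.extend E w'
  have hZ : ContMDiffAt I I.tangent ∞ (fun y ↦ (⟨y, Z y⟩ : TangentBundle I M)) x :=
    FiberBundle.contMDiffAt_extend I E w'
  have hbr {U V : (y : M) → TangentSpace I y}
      (hU : ContMDiffAt I I.tangent ∞ (fun y ↦ (⟨y, U y⟩ : TangentBundle I M)) x)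
      (hV : ContMDiffAt I I.tangent ∞ (fun y ↦ (⟨y, V y⟩ : TangentBundle I M)) x) :
      MDifferentiableAt I I.tangent
        (fun y ↦ (⟨y, mlieBracket I U V y⟩ : TangentBundle I M)) x := by
    have : IsManifold I ((⊤ : ℕ∞) + 1) M := inferInstanceAs (IsManifold I ∞ M)
    refine (ContMDiffAt.mlieBracket_vectorField (m := 1) (n := ⊤) hU hV ?_).mdifferentiableAt
      one_ne_zero
    rw [minSmoothness_of_isRCLikeNormedField]
    exact_mod_cast le_top
  have hev {U : (y : M) → TangentSpace I y}
      (hU : ContMDiffAt I I.tangent ∞ (fun y ↦ (⟨y, U y⟩ : TangentBundle I M)) x) :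
      mlieBracket I U (g • Z) =ᶠ[𝓝 x]
        (fun y ↦ mvfderiv I g y (U y)) • Z + g • mlieBracket I U Z := by
    have h1 := contMDiffAt_iff_contMDiffAt_nhds (by simp) |>.1 (hg.of_le (m := 1) (by simp))
    have h2 := contMDiffAt_iff_contMDiffAt_nhds (by simp) |>.1 (hZ.of_le (m := 1) (by simp))
    filter_upwards [h1, h2] with y hgy hZy
    exact mlieBracket_smul_right (hgy.mdifferentiableAt one_ne_zero)
      (hZy.mdifferentiableAt one_ne_zero)
  have hgd := hg.mdifferentiableAt (by simp)
  have hZd := hZ.mdifferentiableAt (by simp)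
  have hsnd {U V : (y : M) → TangentSpace I y}
      (hU : ContMDiffAt I I.tangent ∞ (fun y ↦ (⟨y, U y⟩ : TangentBundle I M)) x) :
      mlieBracket I V (mlieBracket I U (g • Z)) x =
        mvfderiv I (fun y ↦ mvfderiv I g y (U y)) x (V x) • Z x
        + mvfderiv I g x (U x) • mlieBracket I V Z x
        + (mvfderiv I g x (V x) • mlieBracket I U Z x
        + g x • mlieBracket I V (mlieBracket I U Z) x) := by
    have hUg := (hg.mvfderiv_apply hU).mdifferentiableAt (by simp)
    rw [Filter.EventuallyEq.mlieBracket_vectorField_eq (V₁ := V) Filter.EventuallyEq.rfl (hev hU),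
      mlieBracket_add_right, mlieBracket_smul_right hUg hZd,
      mlieBracket_smul_right hgd (hbr hU hZ)]
    · exact hUg.smul_section hZd
    · exact hgd.smul_section (hbr hU hZ)
  have hgZ : ContMDiffAt I I.tangent ∞ (fun y ↦ (⟨y, (g • Z) y⟩ : TangentBundle I M)) x :=
    hg.smul_section hZ
  have key := leibniz_identity_mlieBracket_apply (hX.of_le hle) (hY.of_le hle) (hgZ.of_le hle)
  have key' := leibniz_identity_mlieBracket_apply (hX.of_le hle) (hY.of_le hle) (hZ.of_le hle)
  rw [hsnd hY, hsnd hX, mlieBracket_smul_right hgd hZd, key'] at key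
  have hzero : (mvfderiv I g x (mlieBracket I X Y x) -
      (mvfderiv I (fun y ↦ mvfderiv I g y (Y y)) x (X x)
        - mvfderiv I (fun y ↦ mvfderiv I g y (X y)) x (Y x))) • Z x = 0 := by
    rw [← sub_eq_zero] at key
    rw [← neg_eq_zero, ← key]
    module
  have hZx : Z x ≠ 0 := by
    simp only [Z, FiberBundle.extend_apply_self]
    exact hw
  exact sub_eq_zero.1 ((smul_eq_zero.1 hzero).resolve_right hZx)

/-- The Lie bracket acts on smooth vector-valued functions as the commutator of derivations. -/
theorem mvfderiv_mlieBracket_apply {F : Type*} [NormedAddCommGroup F] [NormedSpace ℝ F]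
    {g : M → F} {X Y : (y : M) → TangentSpace I y} {x : M}
    (hg : ContMDiffAt I 𝓘(ℝ, F) ∞ g x)
    (hX : ContMDiffAt I I.tangent ∞ (fun y ↦ (⟨y, X y⟩ : TangentBundle I M)) x)
    (hY : ContMDiffAt I I.tangent ∞ (fun y ↦ (⟨y, Y y⟩ : TangentBundle I M)) x) :
    mvfderiv I g x (mlieBracket I X Y x) =
      mvfderiv I (fun y ↦ mvfderiv I g y (Y y)) x (X x)
        - mvfderiv I (fun y ↦ mvfderiv I g y (X y)) x (Y x) := by
  refine SeparatingDual.eq_iff_forall_dual_eq (R := ℝ) |>.2 fun l ↦ ?_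
  have hl {h : M → F} {y : M} (hh : MDifferentiableAt I 𝓘(ℝ, F) h y) (v : TangentSpace I y) :
      l (mvfderiv I h y v) = mvfderiv I (fun z ↦ l (h z)) y v := by
    have := mfderiv_comp_apply y (I' := 𝓘(ℝ, F)) (I'' := 𝓘(ℝ, ℝ)) (g := l)
      l.mdifferentiableAt hh v
    rw [ContinuousLinearMap.mfderiv_eq] at this
    exact this.symm
  have hev : ∀ᶠ y in 𝓝 x, MDifferentiableAt I 𝓘(ℝ, F) g y := by
    have h1 := contMDiffAt_iff_contMDiffAt_nhds (by simp) |>.1 (hg.of_le (m := 1) (by simp))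
    filter_upwards [h1] with y hy using hy.mdifferentiableAt one_ne_zero
  have hcongr (U : (y : M) → TangentSpace I y) (v : TangentSpace I x) :
      mvfderiv I (fun y ↦ l (mvfderiv I g y (U y))) x v =
        mvfderiv I (fun y ↦ mvfderiv I (fun z ↦ l (g z)) y (U y)) x v := by
    have : (fun y ↦ l (mvfderiv I g y (U y))) =ᶠ[𝓝 x]
        fun y ↦ mvfderiv I (fun z ↦ l (g z)) y (U y) := by
      filter_upwards [hev] with y hy using hl hy _
    rw [this.mvfderiv_eq]
  rw [map_sub, hl hev.self_of_nhds, hl ((hg.mvfderiv_apply hY).mdifferentiableAt (by simp)),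
    hl ((hg.mvfderiv_apply hX).mdifferentiableAt (by simp)), hcongr, hcongr]
  exact mvfderiv_mlieBracket_apply_real (l.contMDiff.contMDiffAt.comp x hg) hX hY

end LieBracketDerivation

section Coordinates

open scoped Topology

variable {E : Type*} [NormedAddCommGroup E] [NormedSpace ℝ E] [FiniteDimensional ℝ E]
  {H : Type*} [TopologicalSpace H] {I : ModelWithCorners ℝ E H}
  {F : Type*} [NormedAddCommGroup F] [NormedSpace ℝ F] [FiniteDimensional ℝ F]
  {G : Type*} [TopologicalSpace G] {J : ModelWithCorners ℝ F G}
  {M : Type*} [TopologicalSpace M] [ChartedSpace H M] [IsManifold I ∞ M]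
  {N : Type*} [TopologicalSpace N] [ChartedSpace G N] [IsManifold J ∞ N]

variable (J) in
/-- The coordinates at `y` of tangent vectors of `N`, in the preferred trivialization at `y₀`. -/
def tangentCoord (y₀ y : N) : TangentSpace J y →L[ℝ] F :=
  (trivializationAt F (TangentSpace J) y₀).continuousLinearMapAt ℝ y

variable (J) in
/-- The tangent vector at `y` with given coordinates in the preferred trivialization at `y₀`. -/
def tangentCoordSymm (y₀ y : N) : F →L[ℝ] TangentSpace J y :=
  (trivializationAt F (TangentSpace J) y₀).symmL ℝ y

omit [FiniteDimensional ℝ F] in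
theorem tangentCoord_apply {y₀ y : N} (hy : y ∈ (chartAt G y₀).source) (v : TangentSpace J y) :
    tangentCoord J y₀ y v =
      (trivializationAt F (fun y : N ↦ TangentSpace J y) y₀ (⟨y, v⟩ : TangentBundle J N)).2 := by
  simp only [tangentCoord]
  rw [Trivialization.continuousLinearMapAt_apply, Trivialization.linearMapAt_apply, if_pos (by exact hy)]

omit [FiniteDimensional ℝ F] in
theorem tangentCoordSymm_tangentCoord {y₀ y : N} (hy : y ∈ (chartAt G y₀).source)
    (v : TangentSpace J y) : tangentCoordSymm J y₀ y (tangentCoord J y₀ y v) = v :=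
  (trivializationAt F (TangentSpace J) y₀).symmL_continuousLinearMapAt hy v

omit [FiniteDimensional ℝ F] in
theorem tangentCoord_tangentCoordSymm {y₀ y : N} (hy : y ∈ (chartAt G y₀).source) (w : F) :
    tangentCoord J y₀ y (tangentCoordSymm J y₀ y w) = w :=
  (trivializationAt F (TangentSpace J) y₀).continuousLinearMapAt_symmL hy w

omit [FiniteDimensional ℝ F] in
theorem tangentCoord_injective {y₀ y : N} (hy : y ∈ (chartAt G y₀).source) :
    Function.Injective (tangentCoord J y₀ y) :=
  Function.LeftInverse.injective (tangentCoordSymm_tangentCoord hy)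

omit [FiniteDimensional ℝ F] in
theorem tangentCoord_eq_mvfderiv {y₀ y : N} (hy : y ∈ (chartAt G y₀).source)
    (v : TangentSpace J y) : tangentCoord J y₀ y v = mvfderiv J (extChartAt J y₀) y v := by
  simp only [tangentCoord]
  rw [TangentBundle.continuousLinearMapAt_trivializationAt hy]
  rfl

omit [FiniteDimensional ℝ F] in
theorem extend_eq_tangentCoordSymm {y₀ y : N} (hy : y ∈ (chartAt G y₀).source)
    (v : TangentSpace J y₀) :
    FiberBundle.extend F (E := fun y : N ↦ TangentSpace J y) v y
      = tangentCoordSymm J y₀ y (tangentCoord J y₀ y₀ v) := by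
  rw [tangentCoord_apply (mem_chart_source G y₀), tangentCoordSymm, Trivialization.symmL_apply]
  · rfl
  · exact hy

omit [FiniteDimensional ℝ E] [FiniteDimensional ℝ F] [IsManifold I ∞ M] in
variable (I J) in
/-- Differentiability of a vector field along a map, in coordinates. -/
theorem mdifferentiableAt_tangentCoord {f : M → N} {V : (x : M) → TangentSpace J (f x)} {x : M}
    (hV : MDifferentiableAt I J.tangent (fun z ↦ (⟨f z, V z⟩ : TangentBundle J N)) x) :
    MDifferentiableAt I 𝓘(ℝ, F) (fun z ↦ tangentCoord J (f x) (f z) (V z)) x := by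
  obtain ⟨hf, h2⟩ := (mdifferentiableAt_totalSpace (IB := J) (F := F) _).1 hV
  refine h2.congr_of_eventuallyEq ?_
  filter_upwards [hf.continuousAt.preimage_mem_nhds (chart_source_mem_nhds G (f x))] with z hz
  exact tangentCoord_apply hz _

omit [FiniteDimensional ℝ F] in
/-- The Lie bracket in coordinates, pushed forward by a map `f`. -/
theorem tangentCoord_mfderiv_mlieBracket {f : M → N} {X Y : (x : M) → TangentSpace I x} {x : M}
    (hf : ContMDiffAt I J ∞ f x)
    (hX : ContMDiffAt I I.tangent ∞ (fun y ↦ (⟨y, X y⟩ : TangentBundle I M)) x)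
    (hY : ContMDiffAt I I.tangent ∞ (fun y ↦ (⟨y, Y y⟩ : TangentBundle I M)) x) :
    tangentCoord J (f x) (f x) (mfderiv I J f x (mlieBracket I X Y x)) =
      mvfderiv I (fun z ↦ tangentCoord J (f x) (f z) (mfderiv I J f z (Y z))) x (X x)
      - mvfderiv I (fun z ↦ tangentCoord J (f x) (f z) (mfderiv I J f z (X z))) x (Y x) := by
  have hev : ∀ᶠ z in 𝓝 x, MDifferentiableAt I J f z := by
    have h1 := contMDiffAt_iff_contMDiffAt_nhds (by simp) |>.1 (hf.of_le (m := 1) (by simp))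
    filter_upwards [h1] with y hy using hy.mdifferentiableAt one_ne_zero
  have hcoord : ∀ᶠ z in 𝓝 x, ∀ v : TangentSpace I z,
      tangentCoord J (f x) (f z) (mfderiv I J f z v)
        = mvfderiv I (fun z ↦ extChartAt J (f x) (f z)) z v := by
    filter_upwards [hev, hf.continuousAt.preimage_mem_nhds (chart_source_mem_nhds G (f x))]
      with z hz hsrc v
    rw [tangentCoord_eq_mvfderiv hsrc]
    exact (mfderiv_comp_apply z (mdifferentiableAt_extChartAt hsrc) hz v).symm
  have hg : ContMDiffAt I 𝓘(ℝ, F) ∞ (fun z ↦ extChartAt J (f x) (f z)) x :=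
    contMDiffAt_extChartAt.comp x hf
  have hc (U : (x : M) → TangentSpace I x) :
      mvfderiv I (fun z ↦ tangentCoord J (f x) (f z) (mfderiv I J f z (U z))) x
        = mvfderiv I (fun z ↦ mvfderiv I (fun z ↦ extChartAt J (f x) (f z)) z (U z)) x := by
    refine Filter.EventuallyEq.mvfderiv_eq ?_
    filter_upwards [hcoord] with z hz using hz _
  rw [hcoord.self_of_nhds, hc, hc]
  exact mvfderiv_mlieBracket_apply hg hX hY

/-- The Lie bracket in coordinates. -/
theorem tangentCoord_mlieBracket {X Y : (y : N) → TangentSpace J y} {y : N}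
    (hX : ContMDiffAt J J.tangent ∞ (fun y ↦ (⟨y, X y⟩ : TangentBundle J N)) y)
    (hY : ContMDiffAt J J.tangent ∞ (fun y ↦ (⟨y, Y y⟩ : TangentBundle J N)) y) :
    tangentCoord J y y (mlieBracket J X Y y) =
      mvfderiv J (fun z ↦ tangentCoord J y z (Y z)) y (X y)
      - mvfderiv J (fun z ↦ tangentCoord J y z (X z)) y (Y y) := by
  have := tangentCoord_mfderiv_mlieBracket (J := J) (f := @id N) contMDiffAt_id hX hY
  simpa [mfderiv_id] using! this

omit [FiniteDimensional ℝ F] in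
theorem mvfderiv_tangentCoord_extend {y : N} (v : TangentSpace J y) :
    mvfderiv J (fun z ↦ tangentCoord J y z
      (FiberBundle.extend F (E := fun y : N ↦ TangentSpace J y) v z)) y = 0 := by
  have : (fun z ↦ tangentCoord J y z
      (FiberBundle.extend F (E := fun y : N ↦ TangentSpace J y) v z)) =ᶠ[𝓝 y]
      fun _ ↦ tangentCoord J y y v := by
    filter_upwards [chart_source_mem_nhds G y] with z hz
    rw [extend_eq_tangentCoordSymm hz, tangentCoord_tangentCoordSymm hz]
  rw [this.mvfderiv_eq, mvfderiv_const]

theorem mlieBracket_extend_extend {y : N} (v w : TangentSpace J y) :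
    mlieBracket J (FiberBundle.extend F (E := fun y : N ↦ TangentSpace J y) v)
      (FiberBundle.extend F (E := fun y : N ↦ TangentSpace J y) w) y = 0 := by
  apply tangentCoord_injective (mem_chart_source G y)
  rw [tangentCoord_mlieBracket (FiberBundle.contMDiffAt_extend J F v)
    (FiberBundle.contMDiffAt_extend J F w), mvfderiv_tangentCoord_extend,
    mvfderiv_tangentCoord_extend]
  simp

/-- A covariant derivative in coordinates: the difference to the flat connection of the preferred
trivialization is a tensor. -/
theorem CovariantDerivative.apply_eq_extend_add
    (nabla : CovariantDerivative J F (fun y : N ↦ TangentSpace J y))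
    {X : (y : N) → TangentSpace J y} {y : N}
    (hX : MDifferentiableAt J J.tangent (fun y ↦ (⟨y, X y⟩ : TangentBundle J N)) y)
    (v : TangentSpace J y) :
    nabla X y v = nabla (FiberBundle.extend F (X y)) y v
      + tangentCoordSymm J y y (mvfderiv J (fun z ↦ tangentCoord J y z (X z)) y v) := by
  have hd {σ : (y : N) → TangentSpace J y}
      (hσ : MDifferentiableAt J J.tangent (fun y ↦ (⟨y, σ y⟩ : TangentBundle J N)) y) :
      MDifferentiableAt J 𝓘(ℝ, F) (fun z ↦ tangentCoord J y z (σ z)) y :=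
    mdifferentiableAt_tangentCoord J J (f := fun y : N ↦ y) hσ
  have ht : TensorialAt J F (fun σ : (y : N) → TangentSpace J y ↦ nabla σ y v
      - tangentCoordSymm J y y (mvfderiv J (fun z ↦ tangentCoord J y z (σ z)) y v)) y := by
    constructor
    · intro g σ hg hσ
      have h1 : (fun z ↦ tangentCoord J y z ((g • σ) z))
          = g • fun z ↦ tangentCoord J y z (σ z) := by
        ext z; simp
      simp only [h1]
      rw [nabla.isCovariantDerivativeOnUniv.leibniz hσ hg, mvfderiv_smul hg (hd hσ)]
      simp [tangentCoordSymm_tangentCoord (mem_chart_source G y), smul_sub]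
    · intro σ τ hσ hτ
      have h1 : (fun z ↦ tangentCoord J y z ((σ + τ) z))
          = (fun z ↦ tangentCoord J y z (σ z)) + fun z ↦ tangentCoord J y z (τ z) := by
        ext z; simp
      simp only [h1]
      rw [nabla.isCovariantDerivativeOnUniv.add hσ hτ, mvfderiv_add (hd hσ) (hd hτ)]
      simp only [add_apply, map_add]
      abel
  have := ht.pointwise hX (FiberBundle.mdifferentiableAt_extend J F (X y)) (by simp)
  simp only [mvfderiv_tangentCoord_extend] at this
  simp only [zero_apply, map_zero, sub_zero] at this
  rw [← this]
  abel

end Coordinates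

section AlongMap

open scoped Topology

variable {E : Type*} [NormedAddCommGroup E] [NormedSpace ℝ E] [FiniteDimensional ℝ E]
  {H : Type*} [TopologicalSpace H] {I : ModelWithCorners ℝ E H}
  {F : Type*} [NormedAddCommGroup F] [NormedSpace ℝ F] [FiniteDimensional ℝ F]
  {G : Type*} [TopologicalSpace G] {J : ModelWithCorners ℝ F G}
  {M : Type*} [TopologicalSpace M] [ChartedSpace H M] [IsManifold I ∞ M]
  {N : Type*} [TopologicalSpace N] [ChartedSpace G N] [IsManifold J ∞ N]
  (nabla : CovariantDerivative J F (fun y : N ↦ TangentSpace J y)) {f : M → N}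

theorem CovariantDerivative.apply_neg_of_mdifferentiableAt {X : (y : N) → TangentSpace J y} {y : N}
    (hX : MDifferentiableAt J J.tangent (fun y ↦ (⟨y, X y⟩ : TangentBundle J N)) y) :
    nabla (-X) y = -nabla X y := by
  have := nabla.isCovariantDerivativeOnUniv.smul_const (-1 : ℝ) hX
  simpa using this

theorem CovariantDerivative.apply_extend_neg {y : N} (v : TangentSpace J y) :
    nabla (FiberBundle.extend F (-v)) y = -nabla (FiberBundle.extend F v) y := by
  have hd := FiberBundle.mdifferentiableAt_extend J F v
  rw [← nabla.apply_neg_of_mdifferentiableAt hd]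
  ext u
  have hd' : MDifferentiableAt J J.tangent (fun z ↦ (⟨z, (-(FiberBundle.extend F
      (E := fun y : N ↦ TangentSpace J y) v)) z⟩ : TangentBundle J N)) y :=
    mdifferentiableAt_neg_section hd
  rw [nabla.apply_eq_extend_add hd' u]
  have h1 : (fun z ↦ tangentCoord J y z
      ((-(FiberBundle.extend F (E := fun y : N ↦ TangentSpace J y) v)) z)) =
      -fun z ↦ tangentCoord J y z (FiberBundle.extend F (E := fun y : N ↦ TangentSpace J y) v z) := by
    ext z; simp
  rw [h1, mvfderiv_neg, mvfderiv_tangentCoord_extend]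
  simp

theorem covAlong_eq_tangentCoord (hf : ContinuousAt f x) (V : (x : M) → TangentSpace J (f x))
    (u : TangentSpace I x) :
    covAlong I nabla f V x u = nabla (FiberBundle.extend F (V x)) (f x) (mfderiv I J f x u)
      + tangentCoordSymm J (f x) (f x)
        (mvfderiv I (fun z ↦ tangentCoord J (f x) (f z) (V z)) x u) := by
  have : (fun z ↦ tangentCoord J (f x) (f z) (V z)) =ᶠ[𝓝 x]
      fun z : M ↦ (trivializationAt F (fun y : N ↦ TangentSpace J y) (f x)
          (⟨f z, V z⟩ : TangentBundle J N)).2 := by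
    filter_upwards [hf.preimage_mem_nhds (chart_source_mem_nhds G (f x))] with z hz
    exact tangentCoord_apply hz _
  rw [this.mvfderiv_eq, covAlong, tangentCoordSymm, Trivialization.symmL_apply]
  exact mem_chart_source G (f x)

theorem Filter.EventuallyEq.covAlong_eq {V W : (x : M) → TangentSpace J (f x)} {x : M}
    (h : ∀ᶠ z in 𝓝 x, V z = W z) (u : TangentSpace I x) :
    covAlong I nabla f V x u = covAlong I nabla f W x u := by
  have : (fun z : M ↦ (trivializationAt F (fun y : N ↦ TangentSpace J y) (f x)
          (⟨f z, V z⟩ : TangentBundle J N)).2) =ᶠ[𝓝 x]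
      fun z : M ↦ (trivializationAt F (fun y : N ↦ TangentSpace J y) (f x)
          (⟨f z, W z⟩ : TangentBundle J N)).2 := by
    filter_upwards [h] with z hz
    rw [hz]
  rw [covAlong, covAlong, this.mvfderiv_eq, h.self_of_nhds]

theorem covAlong_neg (hf : ContinuousAt f x) (V : (x : M) → TangentSpace J (f x))
    (u : TangentSpace I x) :
    covAlong I nabla f (-V) x u = -covAlong I nabla f V x u := by
  rw [covAlong_eq_tangentCoord nabla hf, covAlong_eq_tangentCoord nabla hf, Pi.neg_apply,
    nabla.apply_extend_neg]
  have h1 : (fun z ↦ tangentCoord J (f x) (f z) ((-V) z)) =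
      -fun z ↦ tangentCoord J (f x) (f z) (V z) := by
    ext z; simp
  rw [h1, mvfderiv_neg]
  simp only [neg_apply, map_neg]
  abel

theorem covAlong_zero (hf : ContinuousAt f x) (u : TangentSpace I x) :
    covAlong I nabla f (0 : (x : M) → TangentSpace J (f x)) x u = 0 := by
  have h := covAlong_neg nabla hf 0 u
  rw [neg_zero] at h
  have h2 : (2 : ℝ) • covAlong I nabla f (0 : (x : M) → TangentSpace J (f x)) x u = 0 := by
    rw [two_smul]
    nth_rewrite 1 [h]
    exact neg_add_cancel _
  exact (smul_eq_zero.1 h2).resolve_left two_ne_zero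

theorem covAlong_comp {X : (y : N) → TangentSpace J y} (hf : MDifferentiableAt I J f x)
    (hX : MDifferentiableAt J J.tangent (fun y ↦ (⟨y, X y⟩ : TangentBundle J N)) (f x))
    (u : TangentSpace I x) :
    covAlong I nabla f (fun z ↦ X (f z)) x u = nabla X (f x) (mfderiv I J f x u) := by
  rw [covAlong_eq_tangentCoord nabla hf.continuousAt, nabla.apply_eq_extend_add hX]
  have hd := mdifferentiableAt_tangentCoord J J (f := fun y : N ↦ y) hX
  have := mfderiv_comp_apply x hd hf u
  exact congrArg (fun w : F ↦ nabla (FiberBundle.extend F (X (f x))) (f x) (mfderiv I J f x u) +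
    tangentCoordSymm J (f x) (f x) w) this

/-- A torsion-free connection is symmetric along maps. -/
theorem covAlong_pushVF_sub_covAlong_pushVF (htor : nabla.torsion = 0)
    (hf : ContMDiffAt I J ∞ f x) {X Y : (x : M) → TangentSpace I x}
    (hX : ContMDiffAt I I.tangent ∞ (fun y ↦ (⟨y, X y⟩ : TangentBundle I M)) x)
    (hY : ContMDiffAt I I.tangent ∞ (fun y ↦ (⟨y, Y y⟩ : TangentBundle I M)) x) :
    covAlong I nabla f (pushVF I J f Y) x (X x) - covAlong I nabla f (pushVF I J f X) x (Y x)
      = mfderiv I J f x (mlieBracket I X Y x) := by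
  have h1 := covAlong_eq_tangentCoord (I := I) nabla hf.continuousAt (pushVF I J f Y) (X x)
  have h2 := covAlong_eq_tangentCoord (I := I) nabla hf.continuousAt (pushVF I J f X) (Y x)
  have h3 := tangentCoord_mfderiv_mlieBracket hf hX hY
  have h4 := tangentCoordSymm_tangentCoord (mem_chart_source G (f x))
    (mfderiv I J f x (mlieBracket I X Y x))
  rw [h3, map_sub] at h4
  have h5 := nabla.torsion_apply_eq_extend (pushVF I J f X x) (pushVF I J f Y x)
  rw [htor, mlieBracket_extend_extend, FiberBundle.extend_apply_self,
    FiberBundle.extend_apply_self] at h5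
  rw [h1, h2, ← h4]
  simp only [Pi.zero_apply, zero_apply, sub_zero] at h5
  have h6 := sub_eq_zero.1 h5.symm
  simp only [pushVF] at h6 ⊢
  rw [h6]
  abel

end AlongMap

section TangentPart

open scoped Topology

variable {E : Type*} [NormedAddCommGroup E] [NormedSpace ℝ E] [FiniteDimensional ℝ E]
  {H : Type*} [TopologicalSpace H] {I : ModelWithCorners ℝ E H}
  {F : Type*} [NormedAddCommGroup F] [NormedSpace ℝ F] [FiniteDimensional ℝ F]
  {G : Type*} [TopologicalSpace G] {J : ModelWithCorners ℝ F G}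
  {M : Type*} [TopologicalSpace M] [ChartedSpace H M] [IsManifold I ∞ M]
  {N : Type*} [TopologicalSpace N] [ChartedSpace G N] [IsManifold J ∞ N]
  {f : M → N}

theorem IsSmoothVF.pushVF (hf : ContMDiff I J ∞ f) {X : (x : M) → TangentSpace I x}
    (hX : IsSmoothVF I X) :
    ContMDiff I J.tangent ∞ (fun x ↦ (⟨f x, pushVF I J f X x⟩ : TangentBundle J N)) :=
  fun x ↦ ContMDiffAt.clm_apply_of_inCoordinates (b₁ := id) (b₂ := f)
    (ContMDiffAt.mfderiv_const (m := ∞) (hf x) le_rfl) (hX x) (hf x)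

/-- A vector field on an immersed submanifold is smooth if its image is smooth as a vector field
along the immersion. -/
theorem isSmoothVF_of_contMDiff_pushVF (hf : IsImmersedSubmanifold I J f)
    {X : (x : M) → TangentSpace I x}
    (hX : ContMDiff I J.tangent ∞ (fun x ↦ (⟨f x, pushVF I J f X x⟩ : TangentBundle J N))) :
    IsSmoothVF I X := by
  have : CompleteSpace E := FiniteDimensional.complete ℝ E
  intro x₀
  rw [contMDiffAt_section]
  let A : M → (E →L[ℝ] F) := fun z ↦
    (tangentCoord J (f x₀) (f z)).comp ((mfderiv I J f z).comp (tangentCoordSymm I x₀ z))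
  have hA : ContMDiffAt I 𝓘(ℝ, E →L[ℝ] F) ∞ A x₀ :=
    ContMDiffAt.mfderiv_const (m := ∞) (hf.smooth x₀) le_rfl
  have hAinj : Function.Injective (A x₀) := by
    refine (tangentCoord_injective (mem_chart_source G (f x₀))).comp
      ((hf.injective_mfderiv x₀).comp ?_)
    exact Function.LeftInverse.injective (g := tangentCoord I x₀ x₀)
      (tangentCoord_tangentCoordSymm (mem_chart_source H x₀))
  obtain ⟨B₀, hB₀⟩ := (A x₀).toLinearMap.exists_leftInverse_of_injective
    (LinearMap.ker_eq_bot.2 hAinj)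
  let B : F →L[ℝ] E := B₀.toContinuousLinearMap
  let C : M → (E →L[ℝ] E) := fun z ↦ B.comp (A z)
  have hC : ContMDiffAt I 𝓘(ℝ, E →L[ℝ] E) ∞ C x₀ := contMDiffAt_const.clm_comp hA
  have hC₀ : C x₀ = 1 := by
    ext v
    exact DFunLike.congr_fun hB₀ v
  have hunit : ∀ᶠ z in 𝓝 x₀, IsUnit (C z) := by
    refine hC.continuousAt.preimage_mem_nhds (Units.isOpen.mem_nhds ?_)
    change IsUnit (C x₀)
    rw [hC₀]; exact isUnit_one
  have hinv : ContMDiffAt I 𝓘(ℝ, E →L[ℝ] E) ∞ (fun z ↦ Ring.inverse (C z)) x₀ := by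
    have h1 : ContDiffAt ℝ ∞ (Ring.inverse : (E →L[ℝ] E) → _) (C x₀) := by
      rw [hC₀]; exact contDiffAt_ringInverse ℝ 1
    exact h1.contMDiffAt.comp x₀ hC
  have hV : ContMDiffAt I 𝓘(ℝ, F) ∞
      (fun z ↦ tangentCoord J (f x₀) (f z) (pushVF I J f X z)) x₀ := by
    refine ((contMDiffAt_totalSpace).1 (hX x₀)).2.congr_of_eventuallyEq ?_
    filter_upwards [(hf.smooth x₀).continuousAt.preimage_mem_nhds
      (chart_source_mem_nhds G (f x₀))] with z hz
    exact tangentCoord_apply hz _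
  refine (hinv.clm_apply ((contMDiffAt_const (c := B)).clm_apply hV)).congr_of_eventuallyEq ?_
  filter_upwards [hunit, chart_source_mem_nhds H x₀] with z hz hsrc
  have h1 : B (tangentCoord J (f x₀) (f z) (pushVF I J f X z))
      = C z (tangentCoord I x₀ z (X z)) := by
    simp only [C, A, ContinuousLinearMap.comp_apply, pushVF, tangentCoordSymm_tangentCoord hsrc]
  rw [h1, ← tangentCoord_apply hsrc, ← mul_apply_eq_comp, Ring.inverse_mul_cancel _ hz,
    one_apply_eq_self]

theorem isSmoothVF_iff_pushVF (hf : IsImmersedSubmanifold I J f)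
    {X : (x : M) → TangentSpace I x} :
    IsSmoothVF I X ↔
      ContMDiff I J.tangent ∞ (fun x ↦ (⟨f x, pushVF I J f X x⟩ : TangentBundle J N)) :=
  ⟨fun hX ↦ hX.pushVF hf.smooth, isSmoothVF_of_contMDiff_pushVF hf⟩

variable [RiemannianBundle (fun y : N ↦ TangentSpace J y)]

theorem mfderiv_mem_tangentRange (x : M) (u : TangentSpace I x) :
    mfderiv I J f x u ∈ tangentRange I J f x := ⟨u, rfl⟩

theorem normalPart_eq_zero {x : M} {v : TangentSpace J (f x)} (hv : v ∈ tangentRange I J f x) :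
    normalPart I f x v = 0 := by
  rw [normalPart, Submodule.starProjection_eq_self_iff.2 hv, sub_self]

theorem normalPart_add {x : M} (v w : TangentSpace J (f x)) :
    normalPart I f x (v + w) = normalPart I f x v + normalPart I f x w := by
  simp only [normalPart, map_add]; abel

theorem normalPart_sub {x : M} (v w : TangentSpace J (f x)) :
    normalPart I f x (v - w) = normalPart I f x v - normalPart I f x w := by
  simp only [normalPart, map_sub]; abel

theorem normalPart_neg {x : M} (v : TangentSpace J (f x)) :
    normalPart I f x (-v) = -normalPart I f x v := by
  simp only [normalPart, map_neg]; abel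

theorem normalPart_smul {x : M} (c : ℝ) (v : TangentSpace J (f x)) :
    normalPart I f x (c • v) = c • normalPart I f x v := by
  simp only [normalPart, map_smul, smul_sub]

theorem mfderiv_tangentPart {x : M} {v : TangentSpace J (f x)} (hv : v ∈ tangentRange I J f x) :
    mfderiv I J f x (tangentPart I f x v) = v := by
  rw [tangentPart, Submodule.starProjection_eq_self_iff.2 hv]
  obtain ⟨u, rfl⟩ := hv
  exact Function.invFun_eq ⟨u, rfl⟩

theorem tangentPart_mfderiv {x : M} (hf : Function.Injective (mfderiv I J f x))
    (u : TangentSpace I x) : tangentPart I f x (mfderiv I J f x u) = u :=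
  hf (mfderiv_tangentPart (mfderiv_mem_tangentRange x u))

end TangentPart

section SecondFundamentalForm

open scoped Topology

variable {E : Type*} [NormedAddCommGroup E] [NormedSpace ℝ E] [FiniteDimensional ℝ E]
  {H : Type*} [TopologicalSpace H] {I : ModelWithCorners ℝ E H}
  {F : Type*} [NormedAddCommGroup F] [NormedSpace ℝ F] [FiniteDimensional ℝ F]
  {G : Type*} [TopologicalSpace G] {J : ModelWithCorners ℝ F G}
  {M : Type*} [TopologicalSpace M] [ChartedSpace H M] [IsManifold I ∞ M]
  {N : Type*} [TopologicalSpace N] [ChartedSpace G N] [IsManifold J ∞ N]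
  [RiemannianBundle (fun y : N ↦ TangentSpace J y)]
  (nabla : CovariantDerivative J F (fun y : N ↦ TangentSpace J y)) {f : M → N}

theorem sff_congr_left {X X' : (x : M) → TangentSpace I x} (Y : (x : M) → TangentSpace I x) {x : M}
    (h : X x = X' x) : sff I nabla f X Y x = sff I nabla f X' Y x := by
  rw [sff, sff, h]

theorem sff_congr_right (X : (x : M) → TangentSpace I x) {Y Y' : (x : M) → TangentSpace I x} {x : M}
    (h : Y =ᶠ[𝓝 x] Y') : sff I nabla f X Y x = sff I nabla f X Y' x := by
  rw [sff, sff, Filter.EventuallyEq.covAlong_eq (V := pushVF I J f Y) (W := pushVF I J f Y')]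
  filter_upwards [h] with z hz
  rw [pushVF, pushVF, hz]

theorem covAlong_add_apply (hf : Continuous f) (V : (x : M) → TangentSpace J (f x)) {x : M}
    (u v : TangentSpace I x) :
    covAlong I nabla f V x (u + v) = covAlong I nabla f V x u + covAlong I nabla f V x v := by
  simp only [covAlong_eq_tangentCoord nabla hf.continuousAt, map_add]
  abel

theorem covAlong_smul_apply (hf : Continuous f) (V : (x : M) → TangentSpace J (f x)) {x : M}
    (c : ℝ) (u : TangentSpace I x) :
    covAlong I nabla f V x (c • u) = c • covAlong I nabla f V x u := by
  simp only [covAlong_eq_tangentCoord nabla hf.continuousAt, map_smul, smul_add]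

theorem sff_add_left (hf : Continuous f) (X X' Y : (x : M) → TangentSpace I x) (x : M) :
    sff I nabla f (X + X') Y x = sff I nabla f X Y x + sff I nabla f X' Y x := by
  rw [sff, sff, sff, ← normalPart_add, ← covAlong_add_apply nabla hf]
  rfl

theorem sff_smul_left (hf : Continuous f) (c : ℝ) (X Y : (x : M) → TangentSpace I x) (x : M) :
    sff I nabla f (c • X) Y x = c • sff I nabla f X Y x := by
  rw [sff, sff, ← normalPart_smul, ← covAlong_smul_apply nabla hf]
  rfl

theorem sff_comm (htor : nabla.torsion = 0) (hf : ContMDiff I J ∞ f)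
    {X Y : (x : M) → TangentSpace I x} (hX : IsSmoothVF I X) (hY : IsSmoothVF I Y) (x : M) :
    sff I nabla f X Y x = sff I nabla f Y X x := by
  rw [← sub_eq_zero, sff, sff, ← normalPart_sub,
    covAlong_pushVF_sub_covAlong_pushVF nabla htor (hf x) (hX x) (hY x)]
  exact normalPart_eq_zero (mfderiv_mem_tangentRange x _)

theorem pushVF_zero : pushVF I J f 0 = 0 := by
  ext x; simp [pushVF]

theorem normalCov_neg (hf : Continuous f) (X : (x : M) → TangentSpace I x)
    (V : (x : M) → TangentSpace J (f x)) (x : M) :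
    normalCov I nabla f X (-V) x = -normalCov I nabla f X V x := by
  rw [normalCov, normalCov, covAlong_neg nabla hf.continuousAt, normalPart_neg]

theorem normalCov_zero (hf : Continuous f) (X : (x : M) → TangentSpace I x) (x : M) :
    normalCov I nabla f X 0 x = 0 := by
  rw [normalCov, covAlong_zero nabla hf.continuousAt]
  exact normalPart_eq_zero (zero_mem _)

theorem sff_zero_right (hf : Continuous f) (X : (x : M) → TangentSpace I x) (x : M) :
    sff I nabla f X 0 x = 0 := by
  rw [sff, pushVF_zero]
  exact normalCov_zero nabla hf X x

/-- The operator `R̄(X, ξ) · h` evaluated at `(Z, ξ)`, for a vector field `ξ` with `h(·, ξ) = 0` and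
`∇_ξ ξ = 0`. -/
theorem curvatureSff_apply_of_sff_eq_zero (him : IsImmersedSubmanifold I J f)
    {ξ : (x : M) → TangentSpace I x}
    (hξ : ∀ Z, sff I nabla f Z ξ = 0) (hξξ : inducedCov I nabla f ξ ξ = 0)
    (X Z : (x : M) → TangentSpace I x) (x : M) :
    curvatureSff I nabla f X ξ Z ξ x =
      sff I nabla f Z (inducedCov I nabla f ξ (inducedCov I nabla f X ξ)) x
      + sff I nabla f Z (inducedCov I nabla f (mlieBracket I X ξ) ξ) x := by
  have hf := him.smooth.continuous
  have h1 (Y W : (x : M) → TangentSpace I x) :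
      covTensor I nabla f Y (sff I nabla f) W ξ = -sff I nabla f W (inducedCov I nabla f Y ξ) := by
    ext z
    rw [covTensor, hξ, hξ, normalCov_zero nabla hf]
    simp
  have h2 (W : (x : M) → TangentSpace I x) : sff I nabla f W 0 = 0 :=
    funext fun z ↦ sff_zero_right nabla hf W z
  have h3 (Y W : (x : M) → TangentSpace I x) : covTensor I nabla f Y (sff I nabla f) W 0 =
      -sff I nabla f W (inducedCov I nabla f Y 0) := by
    ext z
    rw [covTensor, h2, h2, normalCov_zero nabla hf]
    simp
  have h4 (Y : (x : M) → TangentSpace I x) : inducedCov I nabla f Y 0 = 0 := by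
    ext z
    rw [inducedCov, pushVF_zero, covAlong_zero nabla hf.continuousAt]
    have := tangentPart_mfderiv (him.injective_mfderiv z) 0
    rwa [map_zero] at this
  have h5 (W : (x : M) → TangentSpace I x) : covTensor I nabla f ξ (sff I nabla f) W ξ = 0 := by
    rw [h1, hξξ, h2, neg_zero]
  have hA : covTensor I nabla f X (covTensor I nabla f ξ (sff I nabla f)) Z ξ x =
      -covTensor I nabla f ξ (sff I nabla f) Z (inducedCov I nabla f X ξ) x := by
    rw [covTensor, h5, h5, normalCov_zero nabla hf]
    simp
  have hB : covTensor I nabla f ξ (covTensor I nabla f X (sff I nabla f)) Z ξ x =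
      -normalCov I nabla f ξ (sff I nabla f Z (inducedCov I nabla f X ξ)) x
        + sff I nabla f (inducedCov I nabla f ξ Z) (inducedCov I nabla f X ξ) x := by
    rw [covTensor, h1, h1, hξξ, h3, h4, h2, normalCov_neg nabla hf]
    simp
  rw [curvatureSff, hA, hB, h1, covTensor, Pi.neg_apply]
  abel

end SecondFundamentalForm

section LieDerivativePhi

open scoped Topology

variable {E : Type*} [NormedAddCommGroup E] [NormedSpace ℝ E] [FiniteDimensional ℝ E]
  {H : Type*} [TopologicalSpace H] {I : ModelWithCorners ℝ E H}
  {F : Type*} [NormedAddCommGroup F] [NormedSpace ℝ F] [FiniteDimensional ℝ F]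
  {G : Type*} [TopologicalSpace G] {J : ModelWithCorners ℝ F G}
  {M : Type*} [TopologicalSpace M] [ChartedSpace H M] [IsManifold I ∞ M]
  {N : Type*} [TopologicalSpace N] [ChartedSpace G N] [IsManifold J ∞ N]
  [RiemannianBundle (fun y : N ↦ TangentSpace J y)]
  (S : AlmostContactMetric J N) {f : M → N}

theorem mvfderiv_clm_apply {F₁ F₂ : Type*} [NormedAddCommGroup F₁] [NormedSpace ℝ F₁]
    [NormedAddCommGroup F₂] [NormedSpace ℝ F₂] {A : M → F₁ →L[ℝ] F₂} {g : M → F₁} {x : M}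
    (hA : MDifferentiableAt I 𝓘(ℝ, F₁ →L[ℝ] F₂) A x) (hg : MDifferentiableAt I 𝓘(ℝ, F₁) g x)
    (u : TangentSpace I x) :
    mvfderiv I (fun z ↦ A z (g z)) x u
      = A x (mvfderiv I g x u) + mvfderiv I A x u (g x) := by
  have h := hA.hasMFDerivAt.2.clm_apply hg.hasMFDerivAt.2
  have e₁ : writtenInExtChartAt I 𝓘(ℝ, F₁ →L[ℝ] F₂) x A (extChartAt I x x) = A x := by
    simp only [writtenInExtChartAt, Function.comp_apply, extChartAt_to_inv]
    rfl
  have e₂ : writtenInExtChartAt I 𝓘(ℝ, F₁) x g (extChartAt I x x) = g x := by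
    simp only [writtenInExtChartAt, Function.comp_apply, extChartAt_to_inv]
    rfl
  rw [e₁, e₂] at h
  have h' : HasMFDerivAt I 𝓘(ℝ, F₂) (fun z ↦ A z (g z)) x _ := ⟨(hA.clm_apply hg).continuousAt, h⟩
  exact DFunLike.congr_fun h'.mfderiv u

namespace AlmostContactMetric

/-- The endomorphism field `φ` in the preferred coordinates at `y₀`. -/
def phiCoord (y₀ y : N) : F →L[ℝ] F :=
  (tangentCoord J y₀ y).comp ((S.phi y).comp (tangentCoordSymm J y₀ y))

theorem mdifferentiableAt_phiCoord (y : N) :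
    MDifferentiableAt J 𝓘(ℝ, F →L[ℝ] F) (S.phiCoord y) y :=
  ((contMDiffAt_hom_bundle _).1 (S.phi_smooth y)).2.mdifferentiableAt (by simp)

theorem tangentCoord_phi {y₀ y : N} (hy : y ∈ (chartAt G y₀).source) (v : TangentSpace J y) :
    tangentCoord J y₀ y (S.phi y v) = S.phiCoord y₀ y (tangentCoord J y₀ y v) := by
  simp [phiCoord, tangentCoordSymm_tangentCoord hy]

theorem contMDiff_phi {V : (x : M) → TangentSpace J (f x)}
    (hV : ContMDiff I J.tangent ∞ (fun x ↦ (⟨f x, V x⟩ : TangentBundle J N))) :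
    ContMDiff I J.tangent ∞ (fun x ↦ (⟨f x, S.phi (f x) (V x)⟩ : TangentBundle J N)) := by
  have hf : ContMDiff I J ∞ f := fun x ↦ ((contMDiffAt_totalSpace).1 (hV x)).1
  exact ContMDiff.clm_bundle_apply (S.phi_smooth.comp hf) hV

/-- The value `[φ w, ξ] - φ[w, ξ]` of the Lie derivative `-L_ξ φ` at `w`, in coordinates at `y`. -/
def lieDerivPhiCoord (y : N) (w : TangentSpace J y) : F :=
  mvfderiv J (fun z ↦ tangentCoord J y z (S.xi z)) y (S.phi y w)
    - mvfderiv J (S.phiCoord y) y (S.xi y) (tangentCoord J y y w)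
    - S.phiCoord y y (mvfderiv J (fun z ↦ tangentCoord J y z (S.xi z)) y w)

theorem tangentCoord_mfderiv_mlieBracket_phi {X PX ξ : (x : M) → TangentSpace I x}
    (hf : ContMDiff I J ∞ f) (hX : IsSmoothVF I X) (hPX : IsSmoothVF I PX) (hξ : IsSmoothVF I ξ)
    (hfξ : ∀ x, mfderiv I J f x (ξ x) = S.xi (f x))
    (hfP : ∀ x, mfderiv I J f x (PX x) = S.phi (f x) (mfderiv I J f x (X x))) (x : M) :
    tangentCoord J (f x) (f x) (mfderiv I J f x (mlieBracket I PX ξ x)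
        - S.phi (f x) (mfderiv I J f x (mlieBracket I X ξ x)))
      = S.lieDerivPhiCoord (f x) (mfderiv I J f x (X x)) := by
  have hfx := (hf x).mdifferentiableAt (by simp)
  have hxid : MDifferentiableAt J 𝓘(ℝ, F) (fun z ↦ tangentCoord J (f x) z (S.xi z)) (f x) :=
    mdifferentiableAt_tangentCoord J J (f := fun y : N ↦ y)
      ((S.xi_smooth (f x)).mdifferentiableAt (by simp))
  have hξc (u : TangentSpace I x) :
      mvfderiv I (fun z ↦ tangentCoord J (f x) (f z) (mfderiv I J f z (ξ z))) x u
        = mvfderiv J (fun z ↦ tangentCoord J (f x) z (S.xi z)) (f x) (mfderiv I J f x u) := by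
    simp only [hfξ]
    exact mfderiv_comp_apply x hxid hfx u
  have hXd : MDifferentiableAt I 𝓘(ℝ, F)
      (fun z ↦ tangentCoord J (f x) (f z) (mfderiv I J f z (X z))) x :=
    mdifferentiableAt_tangentCoord I J ((hX.pushVF hf x).mdifferentiableAt (by simp))
  have hφ := S.mdifferentiableAt_phiCoord (f x)
  have hPc (u : TangentSpace I x) :
      mvfderiv I (fun z ↦ tangentCoord J (f x) (f z) (mfderiv I J f z (PX z))) x u
        = S.phiCoord (f x) (f x) (mvfderiv I
            (fun z ↦ tangentCoord J (f x) (f z) (mfderiv I J f z (X z))) x u)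
          + mvfderiv J (S.phiCoord (f x)) (f x) (mfderiv I J f x u)
            (tangentCoord J (f x) (f x) (mfderiv I J f x (X x))) := by
    have hev : (fun z ↦ tangentCoord J (f x) (f z) (mfderiv I J f z (PX z))) =ᶠ[𝓝 x]
        fun z ↦ S.phiCoord (f x) (f z) (tangentCoord J (f x) (f z) (mfderiv I J f z (X z))) := by
      filter_upwards [(hf x).continuousAt.preimage_mem_nhds
        (chart_source_mem_nhds G (f x))] with z hz
      rw [hfP, S.tangentCoord_phi hz]
    have key := mvfderiv_clm_apply (A := fun z ↦ S.phiCoord (f x) (f z)) (hφ.comp x hfx) hXd u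
    rw [hev.mvfderiv_eq, key]
    congr 2
    exact mfderiv_comp_apply x hφ hfx u
  rw [map_sub, S.tangentCoord_phi (mem_chart_source G (f x)),
    tangentCoord_mfderiv_mlieBracket (hf x) (hPX x) (hξ x),
    tangentCoord_mfderiv_mlieBracket (hf x) (hX x) (hξ x), hξc, hξc, hPc, hfP, hfξ, map_sub,
    lieDerivPhiCoord]
  abel

theorem mlieBracket_phi_eq_smul_xi {X : (y : N) → TangentSpace J y}
    (hnormal : ∀ y, S.nijenhuis X S.xi y = 0) (y : N) :
    ∃ c : ℝ, mlieBracket J (S.phiVF X) S.xi y - S.phi y (mlieBracket J X S.xi y) = c • S.xi y := by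
  have h0 : S.phiVF S.xi = 0 := funext fun z ↦ S.phi_xi z
  have h1 := hnormal y
  rw [nijenhuis, h0, mlieBracket_zero_right, mlieBracket_zero_right] at h1
  have h2 := congrArg (S.phi y) h1
  simp only [Pi.zero_apply, map_zero, map_add, map_sub, map_smul, S.phi_xi] at h2
  simp only [S.phi_phi, map_add, map_neg, map_smul, S.phi_xi, smul_zero,
    add_zero, sub_zero, zero_add] at h2
  refine ⟨S.eta y (mlieBracket J (S.phiVF X) S.xi y), ?_⟩
  rw [← sub_eq_zero, ← h2]
  abel

end AlmostContactMetric

end LieDerivativePhi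

section InvariantSubmanifold

open scoped Topology

variable {E : Type*} [NormedAddCommGroup E] [NormedSpace ℝ E] [FiniteDimensional ℝ E]
  {H : Type*} [TopologicalSpace H] {I : ModelWithCorners ℝ E H}
  {F : Type*} [NormedAddCommGroup F] [NormedSpace ℝ F] [FiniteDimensional ℝ F]
  {G : Type*} [TopologicalSpace G] {J : ModelWithCorners ℝ F G}
  {M : Type*} [TopologicalSpace M] [ChartedSpace H M] [IsManifold I ∞ M]
  {N : Type*} [TopologicalSpace N] [ChartedSpace G N] [IsManifold J ∞ N]
  [RiemannianBundle (fun y : N ↦ TangentSpace J y)]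
  (nabla : CovariantDerivative J F (fun y : N ↦ TangentSpace J y))
  {S : AlmostContactMetric J N} {β : N → ℝ} {f : M → N}

variable (I f) in
/-- The structure vector field `ξ` as a vector field on an invariant submanifold. -/
def reebField (S : AlmostContactMetric J N) (x : M) : TangentSpace I x :=
  tangentPart I f x (S.xi (f x))

variable (I f) in
/-- The vector field `φX` on an invariant submanifold. -/
def phiField (S : AlmostContactMetric J N) (X : (x : M) → TangentSpace I x) (x : M) :
    TangentSpace I x :=
  tangentPart I f x (S.phi (f x) (mfderiv I J f x (X x)))

variable (hf : IsInvariantSubmanifold I f S)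
include hf

theorem mfderiv_reebField (x : M) : mfderiv I J f x (reebField I f S x) = S.xi (f x) :=
  mfderiv_tangentPart (hf.xi_tangent x)

theorem mfderiv_phiField (X : (x : M) → TangentSpace I x) (x : M) :
    mfderiv I J f x (phiField I f S X x) = S.phi (f x) (mfderiv I J f x (X x)) :=
  mfderiv_tangentPart (hf.phi_tangent x _ (mfderiv_mem_tangentRange x _))

theorem isSmoothVF_reebField : IsSmoothVF I (reebField I f S) := by
  rw [isSmoothVF_iff_pushVF hf.immersed]
  simp only [pushVF, mfderiv_reebField hf]
  exact S.xi_smooth.comp hf.immersed.smooth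

theorem isSmoothVF_phiField {X : (x : M) → TangentSpace I x} (hX : IsSmoothVF I X) :
    IsSmoothVF I (phiField I f S X) := by
  rw [isSmoothVF_iff_pushVF hf.immersed]
  simp only [pushVF, mfderiv_phiField hf]
  exact S.contMDiff_phi (hX.pushVF hf.immersed.smooth)

theorem phiField_reebField : phiField I f S (reebField I f S) = 0 := by
  ext x
  apply hf.immersed.injective_mfderiv x
  rw [mfderiv_phiField hf, mfderiv_reebField hf, S.phi_xi, Pi.zero_apply, map_zero]

theorem inducedMetric_reebField (x : M) :
    inducedMetric I J f (reebField I f S) (reebField I f S) x = 1 := by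
  rw [inducedMetric, pushVF, mfderiv_reebField hf, S.inner_xi, S.eta_xi]

theorem exists_mfderiv_mlieBracket_phiField [T2Space N]
    (hnormal : ∀ X Y, IsSmoothVF J X → IsSmoothVF J Y → ∀ y, S.nijenhuis X Y y = 0)
    {X : (x : M) → TangentSpace I x} (hX : IsSmoothVF I X) (x : M) :
    ∃ c : ℝ, mfderiv I J f x (mlieBracket I (phiField I f S X) (reebField I f S) x)
      - S.phi (f x) (mfderiv I J f x (mlieBracket I X (reebField I f S) x)) = c • S.xi (f x) := by
  obtain ⟨Y, hY, hYx⟩ := exists_isSmoothVF_eventuallyEq_extend (I := J) (mfderiv I J f x (X x))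
  have hYx' : Y (f x) = mfderiv I J f x (X x) := by
    rw [hYx.self_of_nhds, FiberBundle.extend_apply_self]
  obtain ⟨c, hc⟩ := S.mlieBracket_phi_eq_smul_xi (hnormal Y S.xi hY S.xi_smooth) (f x)
  refine ⟨c, ?_⟩
  rw [← hc]
  apply tangentCoord_injective (mem_chart_source G (f x))
  rw [S.tangentCoord_mfderiv_mlieBracket_phi hf.immersed.smooth hX (isSmoothVF_phiField hf hX)
    (isSmoothVF_reebField hf) (mfderiv_reebField hf) (mfderiv_phiField hf X) x]
  have h := S.tangentCoord_mfderiv_mlieBracket_phi (f := @id N) contMDiff_id hY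
    (PX := S.phiVF Y) (S.contMDiff_phi (f := @id N) hY) S.xi_smooth (by simp [mfderiv_id])
    (by simp [mfderiv_id, AlmostContactMetric.phiVF]) (f x)
  simp only [mfderiv_id, id_eq, ContinuousLinearMap.id_apply] at h
  rw [h, hYx']

variable (hS : S.IsSQSasakian nabla β)
include hS

theorem covAlong_pushVF_reebField (x : M) (u : TangentSpace I x) :
    covAlong I nabla f (pushVF I J f (reebField I f S)) x u
      = -(β (f x) • S.phi (f x) (mfderiv I J f x u)) := by
  have h : pushVF I J f (reebField I f S) = fun z ↦ S.xi (f z) :=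
    funext fun z ↦ mfderiv_reebField hf z
  rw [h, covAlong_comp nabla ((hf.immersed.smooth x).mdifferentiableAt (by simp))
    ((S.xi_smooth (f x)).mdifferentiableAt (by simp)), hS.nabla_xi]

theorem sff_reebField_right (Z : (x : M) → TangentSpace I x) :
    sff I nabla f Z (reebField I f S) = 0 := by
  ext x
  rw [sff, covAlong_pushVF_reebField nabla hf hS]
  exact normalPart_eq_zero (neg_mem (Submodule.smul_mem _ _
    (hf.phi_tangent x _ (mfderiv_mem_tangentRange x _))))

theorem inducedCov_reebField_right (X : (x : M) → TangentSpace I x) :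
    inducedCov I nabla f X (reebField I f S) =
      (fun x ↦ -β (f x)) • phiField I f S X := by
  ext x
  rw [inducedCov, covAlong_pushVF_reebField nabla hf hS, ← mfderiv_phiField hf, ← map_smul,
    ← map_neg, tangentPart_mfderiv (hf.immersed.injective_mfderiv x)]
  simp

theorem isSmoothVF_inducedCov_reebField_right {X : (x : M) → TangentSpace I x}
    (hX : IsSmoothVF I X) : IsSmoothVF I (inducedCov I nabla f X (reebField I f S)) := by
  rw [inducedCov_reebField_right nabla hf hS]
  exact (hS.beta_smooth.comp hf.immersed.smooth).neg.smul_section (isSmoothVF_phiField hf hX)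

theorem inducedCov_reebField_reebField :
    inducedCov I nabla f (reebField I f S) (reebField I f S) = 0 := by
  rw [inducedCov_reebField_right nabla hf hS, phiField_reebField hf, smul_zero]

variable (htor : nabla.torsion = 0)
include htor

theorem sff_reebField_left {Y : (x : M) → TangentSpace I x} (hY : IsSmoothVF I Y) (x : M) :
    sff I nabla f (reebField I f S) Y x = 0 := by
  rw [sff_comm nabla htor hf.immersed.smooth (isSmoothVF_reebField hf) hY,
    sff_reebField_right nabla hf hS, Pi.zero_apply]

theorem inducedCov_reebField_left {Y : (x : M) → TangentSpace I x} (hY : IsSmoothVF I Y) :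
    inducedCov I nabla f (reebField I f S) Y =
      inducedCov I nabla f Y (reebField I f S) + mlieBracket I (reebField I f S) Y := by
  ext x
  have h := covAlong_pushVF_sub_covAlong_pushVF nabla htor (hf.immersed.smooth x)
    (isSmoothVF_reebField hf x) (hY x)
  rw [sub_eq_iff_eq_add, covAlong_pushVF_reebField nabla hf hS, ← mfderiv_phiField hf,
    ← map_smul, ← map_neg, ← map_add] at h
  rw [inducedCov_reebField_right nabla hf hS, inducedCov, h,
    tangentPart_mfderiv (hf.immersed.injective_mfderiv x)]
  simp [add_comm]

theorem curvatureSff_reebField [T2Space N] {X Z : (x : M) → TangentSpace I x}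
    (hX : IsSmoothVF I X) (hZ : IsSmoothVF I Z) (x : M) :
    curvatureSff I nabla f X (reebField I f S) Z (reebField I f S) x
      = -(β (f x) ^ 2) • sff I nabla f X Z x := by
  have hcont := hf.immersed.smooth.continuous
  have hξ := isSmoothVF_reebField hf
  rw [curvatureSff_apply_of_sff_eq_zero nabla hf.immersed (sff_reebField_right nabla hf hS)
    (inducedCov_reebField_reebField nabla hf hS)]
  set V := inducedCov I nabla f X (reebField I f S) with hV
  have hVs : IsSmoothVF I V := isSmoothVF_inducedCov_reebField_right nabla hf hS hX
  have hA : IsSmoothVF I (inducedCov I nabla f (reebField I f S) V) := by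
    rw [inducedCov_reebField_left nabla hf hS htor hVs]
    exact (isSmoothVF_inducedCov_reebField_right nabla hf hS hVs).add_section
      (isSmoothVF_mlieBracket hξ hVs)
  have hB : IsSmoothVF I
      (inducedCov I nabla f (mlieBracket I X (reebField I f S)) (reebField I f S)) :=
    isSmoothVF_inducedCov_reebField_right nabla hf hS
      (isSmoothVF_mlieBracket hX hξ)
  rw [sff_comm nabla htor hf.immersed.smooth hZ hA, sff_comm nabla htor hf.immersed.smooth hZ hB,
    ← sff_add_left nabla hcont]
  obtain ⟨c, hc⟩ := exists_mfderiv_mlieBracket_phiField hf hS.normal hX x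
  have hβξ : mvfderiv I (fun z ↦ -β (f z)) x (reebField I f S x) = 0 := by
    have h1 := mvfderiv_comp_apply x (g := β)
      ((hS.beta_smooth (f x)).mdifferentiableAt (by simp))
      ((hf.immersed.smooth x).mdifferentiableAt (by simp)) (reebField I f S x)
    rw [mfderiv_reebField hf, hS.xi_beta] at h1
    rw [mvfderiv_fun_neg, neg_apply]
    exact neg_eq_zero.2 h1
  have hbr : mlieBracket I (reebField I f S) V x =
      β (f x) • mlieBracket I (phiField I f S X) (reebField I f S) x := by
    rw [hV, inducedCov_reebField_right nabla hf hS, mlieBracket_smul_right, hβξ,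
      mlieBracket_swap_apply]
    · simp
    · exact ((hS.beta_smooth.comp hf.immersed.smooth).neg x).mdifferentiableAt (by simp)
    · exact (isSmoothVF_phiField hf hX x).mdifferentiableAt (by simp)
  have hval : (inducedCov I nabla f (reebField I f S) V +
      inducedCov I nabla f (mlieBracket I X (reebField I f S)) (reebField I f S)) x =
      (-(β (f x) ^ 2) • X + (β (f x) ^ 2 * S.eta (f x) (mfderiv I J f x (X x)) + β (f x) * c) •
        reebField I f S) x := by
    apply hf.immersed.injective_mfderiv x
    rw [inducedCov_reebField_left nabla hf hS htor hVs, inducedCov_reebField_right nabla hf hS,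
      inducedCov_reebField_right nabla hf hS]
    simp only [Pi.add_apply, Pi.smul_apply, Pi.smul_apply', map_add, map_smul,
      mfderiv_phiField hf, mfderiv_reebField hf, hbr]
    rw [hV, inducedCov_reebField_right nabla hf hS]
    simp only [Pi.smul_apply', map_smul, mfderiv_phiField hf, S.phi_phi]
    rw [sub_eq_iff_eq_add.1 hc]
    module
  rw [sff_congr_left nabla Z hval, sff_add_left nabla hcont, sff_smul_left nabla hcont,
    sff_smul_left nabla hcont, sff_reebField_left nabla hf hS htor hZ, smul_zero, add_zero]

theorem tachibana_reebField {X Z : (x : M) → TangentSpace I x} (hZ : IsSmoothVF I Z) (x : M) :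
    tachibana I nabla f X (reebField I f S) Z (reebField I f S) x = sff I nabla f X Z x := by
  rw [tachibana, sff_reebField_right nabla hf hS, sff_reebField_right nabla hf hS,
    sff_reebField_left nabla hf hS htor hZ, inducedMetric_reebField hf]
  simp

theorem isTotallyGeodesic_of_isDeszczPseudoParallel [T2Space N] (L : nonUmbilicSet I nabla f → ℝ)
    (hL : IsDeszczPseudoParallel I nabla f L) (hne : ∀ x, L x + β (f x) ^ 2 ≠ 0) :
    IsTotallyGeodesic I nabla f := by
  intro X Y hX hY x
  have hξ := isSmoothVF_reebField hf
  by_cases hx : x ∈ nonUmbilicSet I nabla f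
  · have h := hL X _ Y _ hX hξ hY hξ ⟨x, hx⟩
    rw [curvatureSff_reebField nabla hf hS htor hX hY,
      tachibana_reebField nabla hf hS htor hY] at h
    have h' : (L ⟨x, hx⟩ + β (f x) ^ 2) • sff I nabla f X Y x = 0 := by
      rw [add_smul, ← h]; module
    exact (smul_eq_zero.1 h').resolve_left (hne ⟨x, hx⟩)
  · have hum {U V : (x : M) → TangentSpace I x} (hU : IsSmoothVF I U) (hV : IsSmoothVF I V) :
        sff I nabla f U V x = inducedMetric I J f U V x • meanCurvature I nabla f x := by
      by_contra hne
      exact hx ⟨U, V, hU, hV, sub_ne_zero.2 hne⟩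
    have h0 := hum hξ hξ
    rw [sff_reebField_right nabla hf hS, inducedMetric_reebField hf, one_smul] at h0
    rw [hum hX hY, ← h0, Pi.zero_apply, smul_zero]

omit hf hS htor in
theorem IsTotallyGeodesic.meanCurvature_eq_zero [T2Space M] (h : IsTotallyGeodesic I nabla f)
    (x : M) : meanCurvature I nabla f x = 0 := by
  rw [meanCurvature, Finset.sum_eq_zero, smul_zero]
  intro i _
  obtain ⟨X, hX, hXx⟩ := exists_isSmoothVF_eventuallyEq_extend (I := I)
    (tangentPart I f x (stdOrthonormalBasis ℝ (tangentRange I J f x) i : TangentSpace J (f x)))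
  rw [← sff_congr_right nabla _ hXx, ← sff_congr_left nabla _ hXx.self_of_nhds]
  exact h X X hX hX x

omit hf hS htor in
theorem IsTotallyGeodesic.nonUmbilicSet_eq_empty [T2Space M] (h : IsTotallyGeodesic I nabla f) :
    nonUmbilicSet I nabla f = ∅ := by
  refine Set.eq_empty_of_forall_notMem fun x ↦ ?_
  rintro ⟨X, Y, hX, hY, hne⟩
  rw [h X Y hX hY, h.meanCurvature_eq_zero, smul_zero, sub_zero] at hne
  exact hne rfl

end InvariantSubmanifold

end

/-- An invariant submanifold `f : M → N` of an SQ-Sasakian manifold `N` is totally geodesic if and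
only if it is Deszcz-pseudo parallel, for some function `L` on `W`, with `L + β² ≠ 0`. -/
theorem theorem3p2 {m n : ℕ}
    {N : Type*} [TopologicalSpace N] [T2Space N]
    [ChartedSpace (EuclideanSpace ℝ (Fin (2 * n + 1))) N] [IsManifold (𝓡 (2 * n + 1)) ∞ N]
    [RiemannianBundle (fun y : N ↦ TangentSpace (𝓡 (2 * n + 1)) y)]
    [IsContMDiffRiemannianBundle (𝓡 (2 * n + 1)) ∞ (EuclideanSpace ℝ (Fin (2 * n + 1)))
      (fun y : N ↦ TangentSpace (𝓡 (2 * n + 1)) y)]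
    {M : Type*} [TopologicalSpace M] [T2Space M]
    [ChartedSpace (EuclideanSpace ℝ (Fin (2 * m + 1))) M] [IsManifold (𝓡 (2 * m + 1)) ∞ M]
    (nabla : CovariantDerivative (𝓡 (2 * n + 1)) (EuclideanSpace ℝ (Fin (2 * n + 1)))
      (fun y : N ↦ TangentSpace (𝓡 (2 * n + 1)) y))
    (hnabla : IsLeviCivita nabla)
    (S : AlmostContactMetric (𝓡 (2 * n + 1)) N) (β : N → ℝ) (hS : S.IsSQSasakian nabla β)
    (f : M → N) (hf : IsInvariantSubmanifold (𝓡 (2 * m + 1)) f S) :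
    IsTotallyGeodesic (𝓡 (2 * m + 1)) nabla f ↔
      ∃ L : nonUmbilicSet (𝓡 (2 * m + 1)) nabla f → ℝ,
        IsDeszczPseudoParallel (𝓡 (2 * m + 1)) nabla f L ∧
          ∀ x : nonUmbilicSet (𝓡 (2 * m + 1)) nabla f, L x + β (f x) ^ 2 ≠ 0 := by
  constructor
  · intro h
    have hW := h.nonUmbilicSet_eq_empty
    exact ⟨fun _ ↦ 0, fun _ _ _ _ _ _ _ _ x ↦ (hW ▸ x.2 : x.1 ∈ (∅ : Set M)).elim,
      fun x ↦ (hW ▸ x.2 : x.1 ∈ (∅ : Set M)).elim⟩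
  · rintro ⟨L, hL, hne⟩
    exact isTotallyGeodesic_of_isDeszczPseudoParallel nabla hf hS hnabla.torsion_free L hL hne
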